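/- Let $G$ be a finite abelian group. A pair $(\Omega,T)$ of subsets of $G$ is a tiling pair if every $g\in G$ can be written uniquely as $g=\omega+t$ with $\omega\in\Omega$, $t\in T$. A nonempty set $A\subseteq G$ is periodic if $A+g=A$ for some $g\in G\setminus\{0\}$. The group $G$ has the periodic tiling (PT) property if for every tiling pair $(\Omega,T)$ of $G$, either $\Omega$ is periodic or there is a periodic set $T'\subseteq G$ such that $(\Omega,T')$ is a tiling pair. Theorem. A nontrivial finite cyclic group has the PT property if and only if it is isomorphic to a subgroup of $\mathbb{Z}_{p_1^n p_2\cdots p_k}$ for some integers $k,n\ge 1$ and some distinct primes $p_1,\dots,p_k$, or to a subgroup of $\mathbb{Z}_{p_1^2p_2^2}$ for some distinct primes $p_1,p_2$. -/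

import Mathlib

/-- `(Ω, T)` is a tiling pair of `G`: every element of `G` is uniquely of the form `ω + t` with
`ω ∈ Ω` and `t ∈ T` (Mathlib's `IsComplement` says that `(ω, t) ↦ ω + t` is a bijection
`Ω × T → G`). -/
def IsTilingPair {G : Type*} [AddCommGroup G] (Ω T : Set G) : Prop :=
  AddSubgroup.IsComplement Ω T

/-- A nonempty set `A` is periodic if `A + g = A` for some non-zero `g`. -/
def IsPeriodicSet {G : Type*} [AddCommGroup G] (A : Set G) : Prop :=
  A.Nonempty ∧ ∃ g : G, g ≠ 0 ∧ (fun a => a + g) '' A = A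

/-- The periodic tiling property: in each tiling pair `(Ω, T)`, either `Ω` is periodic, or `T` can
be replaced by a periodic set. -/
def HasPTProperty (G : Type*) [AddCommGroup G] : Prop :=
  ∀ Ω T : Set G, IsTilingPair Ω T →
    IsPeriodicSet Ω ∨ ∃ T' : Set G, IsPeriodicSet T' ∧ IsTilingPair Ω T'

/-!
Let `N = |G|`. The theorem amounts to: `G` has the periodic tiling property if and only if at most
one prime has its square dividing `N`, or `N = p²q²`.

*Sufficiency.* Tijdeman's theorem (`bijective_smul_add`) says that a factor of a tiling may be
dilated by any integer prime to its size. If a prime `r ∣ N` does not divide `|Ω|`, then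
`r Ω ⊕ T = G`, so that `{x | r x ∈ T}` is a complement of `Ω`, and it is periodic
(`IsTilingPair.exists_periodic_of_not_dvd`). Otherwise all primes of `N` divide `|Ω|`, which leaves
two cases. Either `|T|` is a power of a prime `p`; then dilating `T` into the `p`-part of `G` and
comparing character sums shows that `Ω` or the dilate of `T` is periodic
(`IsTilingPair.periodic_of_card_eq_prime_pow`). Or `N = p²q²` and `|Ω| = |T| = pq`; then the
faithful characters all vanish on one of the two sets, say `A`, by irreducibility of the cyclotomic
polynomial. Hence `A` is a disjoint union of cosets of the subgroups of order `p` and `q`, and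
`|A| = pq` allows only one of the two kinds (`IsTilingPair.periodic_of_card_eq_mul`).

*Necessity.* If `p²q²` properly divides `N`, the subgroup `K` of order `p²q²` contains two
complements `U₁`, `U₂` of the same set `T`, which contain the subgroups of order `p` and of order
`q`, respectively, and are so unlike each other that they share no period
(`exists_pair_of_complements`). Using `U₁` in `K` and `U₂` in the other cosets gives an
aperiodic tile whose differences contain elements of every prime order dividing `N`, so that no complement is periodic (`not_hasPTProperty_of_nsmul_ne_zero`).
-/

/-! ### Dilating a factor of a tiling -/

/-- If `f` and `h` are families whose sums run bijectively over `G`, then `f` may be dilated by any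
prime `r` that does not divide the number of its members. In the group ring over `𝔽_r` the relation
`A * B = ∑ g` gives `A ^ r * B = ∑ g`, and `A ^ r` is the dilate of `A` by Frobenius: each element
has a number of representations congruent to `1` modulo `r`, so at least one. -/
theorem bijective_prime_smul_add {G α β : Type*} [AddCommGroup G] [Fintype α] [Fintype β]
    {f : α → G} {h : β → G} (hb : Function.Bijective fun x : α × β => f x.1 + h x.2)
    {r : ℕ} (hr : r.Prime) (hc : ¬ r ∣ Fintype.card α) :
    Function.Bijective fun x : α × β => r • f x.1 + h x.2 := by
  classical
  have := Fact.mk hr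
  have : Fintype G := Fintype.ofBijective _ hb
  suffices hs : Function.Surjective fun x : α × β => r • f x.1 + h x.2 from
    (Fintype.bijective_iff_surjective_and_card _).2 ⟨hs, Fintype.card_of_bijective hb⟩
  let e : G → AddMonoidAlgebra (ZMod r) G := fun g => AddMonoidAlgebra.single g 1
  have he (x y : G) : e x * e y = e (x + y) := by
    simp [e, AddMonoidAlgebra.single_mul_single]
  have her (x : G) : e x ^ r = e (r • x) := by
    simp [e, AddMonoidAlgebra.single_pow]
  have heS (x : G) : e x * ∑ g, e g = ∑ g, e g := by
    simp only [Finset.mul_sum, he]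
    exact Equiv.sum_comp (Equiv.addLeft x) e
  have hAB : (∑ a, e (f a)) * ∑ b, e (h b) = ∑ g, e g := by
    simp only [Finset.sum_mul_sum, he]
    rw [← Fintype.sum_prod_type' (f := fun a b => e (f a + h b))]
    exact hb.sum_comp e
  have hAS : (∑ a, e (f a)) * ∑ g, e g = (Fintype.card α : ZMod r) • ∑ g, e g := by
    simp only [Finset.sum_mul, heS, Finset.sum_const, Finset.card_univ, Nat.cast_smul_eq_nsmul]
  have hAnS (n : ℕ) :
      (∑ a, e (f a)) ^ n * ∑ g, e g = (Fintype.card α : ZMod r) ^ n • ∑ g, e g := by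
    induction n with
    | zero => simp
    | succ n ih => rw [pow_succ, mul_assoc, hAS, mul_smul_comm, ih, smul_smul, pow_succ, mul_comm]
  have hc' : (Fintype.card α : ZMod r) ≠ 0 := by rwa [Ne, ZMod.natCast_eq_zero_iff]
  have hArB : (∑ a, e (f a)) ^ (r - 1 + 1) * ∑ b, e (h b) = ∑ g, e g := by
    rw [pow_succ, mul_assoc, hAB, hAnS, ZMod.pow_card_sub_one_eq_one hc', one_smul]
  have : CharP (AddMonoidAlgebra (ZMod r) G) r :=
    charP_of_injective_algebraMap (algebraMap (ZMod r) (AddMonoidAlgebra (ZMod r) G)).injective r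
  intro g
  by_contra! hg
  rw [Nat.sub_add_cancel hr.one_le, sum_pow_char, Finset.sum_mul_sum] at hArB
  simp only [her, he] at hArB
  have key := congrArg (fun x => AddMonoidAlgebra.coeff x g) hArB
  have hco (x : G) : AddMonoidAlgebra.coeff (e x) g = if x = g then 1 else 0 := by
    simp [e, Finsupp.single_apply]
  simp only [AddMonoidAlgebra.coeff_sum, Finsupp.finsetSum_apply, hco] at key
  rw [Finset.sum_eq_zero fun a _ => Finset.sum_eq_zero fun b _ => if_neg (hg (a, b))] at key
  simp at key

/-- Tijdeman's theorem: a factor of a tiling may be dilated by any `m` prime to its size. -/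
theorem bijective_smul_add {G α β : Type*} [AddCommGroup G] [Fintype α] [Fintype β]
    {f : α → G} {h : β → G} (hb : Function.Bijective fun x : α × β => f x.1 + h x.2)
    {m : ℕ} (hc : m.Coprime (Fintype.card α)) (hm : m ≠ 0) :
    Function.Bijective fun x : α × β => m • f x.1 + h x.2 := by
  induction m using Nat.recOnMul generalizing f with
  | zero => exact absurd rfl hm
  | one => simpa using hb
  | prime r hr => exact bijective_prime_smul_add hb hr ((Nat.Prime.coprime_iff_not_dvd hr).1 hc)
  | mul a b iha ihb =>
    simp only [mul_smul]
    exact iha (f := fun x => b • f x)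
      (ihb hb (Nat.Coprime.coprime_mul_left hc) (right_ne_zero_of_mul hm))
      (Nat.Coprime.coprime_mul_right hc) (left_ne_zero_of_mul hm)

/-! ### Periodic sets -/

theorem isPeriodicSet_of_forall_add_mem {G : Type*} [AddCommGroup G] [Finite G] {A : Set G}
    (hA : A.Nonempty) {s : G} (hs : s ≠ 0) (h : ∀ x ∈ A, x + s ∈ A) : IsPeriodicSet A := by
  refine ⟨hA, s, hs, Set.eq_of_subset_of_ncard_le ?_ ?_ A.toFinite⟩
  · rintro _ ⟨x, hx, rfl⟩
    exact h x hx
  · rw [Set.ncard_image_of_injective _ (add_left_injective s)]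

theorem IsTilingPair.nonempty_left {G : Type*} [AddCommGroup G] {Ω T : Set G}
    (h : IsTilingPair Ω T) : Ω.Nonempty :=
  let ⟨x, _⟩ := h.2 0
  ⟨x.1, x.1.2⟩

theorem IsTilingPair.nonempty_right {G : Type*} [AddCommGroup G] {Ω T : Set G}
    (h : IsTilingPair Ω T) : T.Nonempty :=
  let ⟨x, _⟩ := h.2 0
  ⟨x.2, x.2.2⟩

theorem IsTilingPair.card_mul {G : Type*} [AddCommGroup G] {Ω T : Set G}
    (h : IsTilingPair Ω T) : Nat.card Ω * Nat.card T = Nat.card G := by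
  rw [← Nat.card_prod]
  exact Nat.card_congr (Equiv.ofBijective _ h)

/-- If a prime `r` divides `|G|` but not `|Ω|`, then `Ω` may be dilated by `r`, and
`{x | r x ∈ T}` is a complement of `Ω`, invariant under the elements of order `r`. -/
theorem IsTilingPair.exists_periodic_of_not_dvd {G : Type*} [AddCommGroup G] [Finite G]
    {Ω T : Set G} (h : IsTilingPair Ω T) {r : ℕ} (hr : r.Prime) (hG : r ∣ Nat.card G)
    (hΩ : ¬ r ∣ Nat.card Ω) : ∃ T' : Set G, IsPeriodicSet T' ∧ IsTilingPair Ω T' := by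
  classical
  have := Fact.mk hr
  have := Fintype.ofFinite G
  have := Fintype.ofFinite Ω
  have := Fintype.ofFinite T
  have hb := bijective_prime_smul_add (f := fun x : Ω => (x : G)) (h := fun x : T => (x : G)) h hr
    (by rwa [← Nat.card_eq_fintype_card])
  have ht : IsTilingPair Ω {x | r • x ∈ T} := by
    constructor
    · rintro ⟨a, x, hx⟩ ⟨b, y, hy⟩ hxy
      have hxy' : (a : G) + x = b + y := hxy
      have := @hb.1 (a, ⟨_, hx⟩) (b, ⟨_, hy⟩)
        (by simp only [← smul_add, hxy'])
      simp only [Prod.mk.injEq] at this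
      obtain ⟨rfl, -⟩ := this
      simpa using hxy'
    · intro g
      obtain ⟨⟨a, t⟩, hat⟩ := hb.2 (r • g)
      refine ⟨(a, ⟨g - a, ?_⟩), by simp⟩
      have : r • (g - (a : G)) = t := by
        rw [smul_sub, ← hat]; simp
      simp [this]
  obtain ⟨s, hs⟩ := exists_prime_addOrderOf_dvd_card' r hG
  refine ⟨_, isPeriodicSet_of_forall_add_mem ht.nonempty_right (s := s) ?_ ?_, ht⟩
  · rintro rfl
    exact hr.one_lt.ne (by simpa using hs)
  · intro x hx
    have : r • s = 0 := hs ▸ addOrderOf_nsmul_eq_zero s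
    simpa [smul_add, this] using hx

theorem IsPeriodicSet.image {G H : Type*} [AddCommGroup G] [AddCommGroup H] (e : G ≃+ H)
    {A : Set G} (hA : IsPeriodicSet A) : IsPeriodicSet (e '' A) := by
  obtain ⟨hne, g, hg, hgA⟩ := hA
  refine ⟨hne.image e, e g, by simpa using hg, ?_⟩
  conv_rhs => rw [← hgA]
  simp only [Set.image_image, map_add]

theorem IsTilingPair.image {G H : Type*} [AddCommGroup G] [AddCommGroup H] (e : G ≃+ H)
    {Ω T : Set G} (h : IsTilingPair Ω T) : IsTilingPair (e '' Ω) (e '' T) := by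
  constructor
  · rintro ⟨⟨_, a, ha, rfl⟩, ⟨_, b, hb, rfl⟩⟩ ⟨⟨_, a', ha', rfl⟩, ⟨_, b', hb', rfl⟩⟩ hab
    have hab' : e a + e b = e a' + e b' := hab
    rw [← map_add, ← map_add, e.injective.eq_iff] at hab'
    have := @h.1 (⟨a, ha⟩, ⟨b, hb⟩) (⟨a', ha'⟩, ⟨b', hb'⟩) hab'
    simp only [Prod.mk.injEq, Subtype.mk.injEq] at this
    simp only [this]
  · intro y
    obtain ⟨⟨a, b⟩, hab⟩ := h.2 (e.symm y)
    refine ⟨(⟨_, a, a.2, rfl⟩, ⟨_, b, b.2, rfl⟩), ?_⟩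
    have hab' : (a : G) + b = e.symm y := hab
    simp [← map_add, hab']

theorem hasPTProperty_of_addEquiv {G H : Type*} [AddCommGroup G] [AddCommGroup H] (e : G ≃+ H)
    (h : HasPTProperty H) : HasPTProperty G := by
  intro Ω T hΩT
  have hback (A : Set G) : e.symm '' (e '' A) = A := by simp [Set.image_image]
  rcases h _ _ (hΩT.image e) with hp | ⟨T', hp, ht⟩
  · exact .inl (hback Ω ▸ hp.image e.symm)
  · exact .inr ⟨_, hp.image e.symm, hback Ω ▸ ht.image e.symm⟩

/-! ### Fourier analysis on `ℤ/N` -/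

open ZMod in
/-- Vanishing of the character sum of a family of residues at the frequency `k` depends only on the
order of `k`: the sum is the value of a polynomial with integer coefficients at a primitive root of
unity of that order, and the cyclotomic polynomials are irreducible. -/
theorem sum_stdAddChar_eq_zero_of_addOrderOf_eq {N : ℕ} [NeZero N] {α : Type*} [Fintype α]
    (f : α → ZMod N) {k l : ZMod N} (hkl : addOrderOf k = addOrderOf l)
    (h : ∑ a, stdAddChar (f a * k) = (0 : ℂ)) : ∑ a, stdAddChar (f a * l) = (0 : ℂ) := by
  let P : Polynomial ℤ := ∑ a, Polynomial.X ^ (f a).val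
  have hP (k : ZMod N) : Polynomial.aeval (stdAddChar k : ℂ) P = ∑ a, stdAddChar (f a * k) := by
    simp only [P, map_sum, map_pow, Polynomial.aeval_X]
    refine Finset.sum_congr rfl fun a _ => ?_
    rw [← AddChar.map_nsmul_eq_pow, nsmul_eq_mul, ZMod.natCast_zmod_val]
  have hprim (k : ZMod N) : IsPrimitiveRoot (stdAddChar k : ℂ) (addOrderOf k) := by
    refine ⟨?_, fun n hn => ?_⟩
    · rw [← AddChar.map_nsmul_eq_pow, addOrderOf_nsmul_eq_zero, AddChar.map_zero_eq_one]
    · rw [← AddChar.map_nsmul_eq_pow, ← AddChar.map_zero_eq_one (stdAddChar (N := N))] at hn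
      exact addOrderOf_dvd_of_nsmul_eq_zero (injective_stdAddChar hn)
  have hpos : 0 < addOrderOf k := addOrderOf_pos k
  have hk := hprim k
  have hl := hkl ▸ hprim l
  have hdvd : minpoly ℤ (stdAddChar k : ℂ) ∣ P :=
    minpoly.isIntegrallyClosed_dvd (hk.isIntegral hpos) (by rw [hP, h])
  rw [← Polynomial.cyclotomic_eq_minpoly hk hpos, Polynomial.cyclotomic_eq_minpoly hl hpos] at hdvd
  rw [← hP]
  exact Polynomial.aeval_eq_zero_of_dvd_aeval_eq_zero hdvd (minpoly.aeval ℤ _)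

open ZMod in
theorem sum_stdAddChar_mul_sum_stdAddChar {N : ℕ} [NeZero N] {α β : Type*} [Fintype α] [Fintype β]
    {f : α → ZMod N} {h : β → ZMod N}
    (hb : Function.Bijective fun x : α × β => f x.1 + h x.2) {k : ZMod N} (hk : k ≠ 0) :
    (∑ a, stdAddChar (f a * k)) * ∑ b, stdAddChar (h b * k) = (0 : ℂ) := by
  simp only [Finset.sum_mul_sum, ← AddChar.map_add_eq_mul, ← add_mul]
  rw [← Fintype.sum_prod_type' (f := fun a b => stdAddChar ((f a + h b) * k)),
    hb.sum_comp (fun x : ZMod N => (stdAddChar (x * k) : ℂ)),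
    AddChar.sum_mulShift k (isPrimitive_stdAddChar N), if_neg hk]
  simp

open ZMod in
theorem dft_comp_add_right {N : ℕ} [NeZero N] (F : ZMod N → ℂ) (s k : ZMod N) :
    dft (fun x => F (x + s)) k = stdAddChar (s * k) * dft F k := by
  simp only [dft_apply, smul_eq_mul, Finset.mul_sum]
  rw [← Equiv.sum_comp (Equiv.addRight s)
    (fun x => stdAddChar (s * k) * (stdAddChar (-(x * k)) * F x))]
  refine Finset.sum_congr rfl fun x _ => ?_
  rw [← mul_assoc, ← AddChar.map_add_eq_mul, Equiv.coe_addRight]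
  congr 2
  ring

open ZMod in
theorem dft_indicator {N : ℕ} [NeZero N] (A : Set (ZMod N)) [Fintype A] (k : ZMod N) :
    dft (A.indicator (1 : ZMod N → ℂ)) k = ∑ a : A, stdAddChar ((a : ZMod N) * -k) := by
  classical
  simp only [dft_apply, smul_eq_mul, mul_neg, Set.indicator_apply, Pi.one_apply, mul_ite, mul_one,
    mul_zero]
  rw [← Finset.sum_filter]
  exact Finset.sum_subtype _ (by simp) _

open ZMod in
/-- A set whose character sums vanish at all frequencies that detect `s` is invariant under `s`. -/
theorem add_mem_of_sum_stdAddChar_eq_zero {N : ℕ} [NeZero N] {A : Set (ZMod N)} [Fintype A]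
    {s : ZMod N}
    (h : ∀ k, s * k ≠ 0 → ∑ a : A, stdAddChar ((a : ZMod N) * k) = (0 : ℂ)) :
    ∀ x ∈ A, x + s ∈ A := by
  have key : (A.indicator (1 : ZMod N → ℂ)) = fun x => A.indicator (1 : ZMod N → ℂ) (x + s) := by
    refine dft.injective (funext fun k => ?_)
    rw [dft_comp_add_right]
    by_cases hk : s * k = 0
    · simp [hk]
    · rw [dft_indicator, h _ (by simpa using hk), mul_zero]
  intro x hx
  by_contra hxs
  simpa [hx, hxs] using congrFun key x

open ZMod in
/-- If the character sums of `A` vanish at all frequencies that detect both `s` and `t`, then the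
mixed second difference `(1 - s)(1 - t)` kills the indicator function of `A`. -/
theorem indicator_add_indicator_of_sum_stdAddChar_eq_zero {N : ℕ} [NeZero N] {A : Set (ZMod N)}
    [Fintype A] {s t : ZMod N}
    (h : ∀ k, s * k ≠ 0 → t * k ≠ 0 → ∑ a : A, stdAddChar ((a : ZMod N) * k) = (0 : ℂ))
    (x : ZMod N) :
    A.indicator (1 : ZMod N → ℂ) x + A.indicator 1 (x + s + t) =
      A.indicator 1 (x + s) + A.indicator 1 (x + t) := by
  let F := A.indicator (1 : ZMod N → ℂ)
  have key : F + (fun x => F (x + s + t)) = (fun x => F (x + s)) + fun x => F (x + t) := by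
    refine dft.injective (funext fun k => ?_)
    simp only [map_add, Pi.add_apply]
    rw [dft_comp_add_right (fun x => F (x + t)), dft_comp_add_right F s, dft_comp_add_right F t]
    by_cases hs : s * k = 0
    · simp [hs]
    by_cases ht : t * k = 0
    · simp [ht, add_comm]
    · rw [dft_indicator, h _ (by simpa using hs) (by simpa using ht)]
      simp
  exact congrFun key x

/-! ### Cyclic groups with a complement of prime power order -/

/-- If `|T|` is a power of a prime `p`, dilate `T` by the prime-to-`p` part `m` of `N`, so that it
lies in the `p`-part `mℤ/N`. At frequencies `k` that do not vanish on the subgroup of order `p`, the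
products `m k` have the same order, so the character sums of `m T` vanish at all of them or at none,
and in the latter case those of `Ω` vanish at all of them. -/
theorem IsTilingPair.periodic_of_card_eq_prime_pow {N : ℕ} [NeZero N] [Nontrivial (ZMod N)]
    {Ω T : Set (ZMod N)} (h : IsTilingPair Ω T) {p a : ℕ} (hp : p.Prime)
    (hT : Nat.card T = p ^ a) :
    IsPeriodicSet Ω ∨ ∃ T' : Set (ZMod N), IsPeriodicSet T' ∧ IsTilingPair Ω T' := by
  have := Fintype.ofFinite Ω
  have := Fintype.ofFinite T
  have hcard := h.card_mul
  rw [Nat.card_zmod] at hcard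
  obtain rfl | ha := Nat.eq_zero_or_pos a
  · left
    obtain ⟨s, hs⟩ := exists_ne (0 : ZMod N)
    have hu : Ω = Set.univ := by
      refine Set.eq_of_subset_of_ncard_le (Set.subset_univ Ω) ?_ Set.finite_univ
      rw [hT, pow_zero, mul_one] at hcard
      rw [Set.ncard_univ, Nat.card_zmod, ← Nat.card_coe_set_eq, hcard]
    exact isPeriodicSet_of_forall_add_mem h.nonempty_left hs fun x _ => hu ▸ trivial
  have hpN : p ∣ N := hcard ▸ (hT ▸ dvd_pow_self p ha.ne').mul_left _
  obtain ⟨n, m, hm, hN⟩ := Nat.exists_eq_pow_mul_and_not_dvd (NeZero.ne N) p hp.ne_one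
  obtain ⟨n, rfl⟩ : ∃ n', n = n' + 1 := by
    refine Nat.exists_eq_succ_of_ne_zero ?_
    rintro rfl
    exact hm (by simpa [hN] using hpN)
  have hm0 : m ≠ 0 := by rintro rfl; exact hm (dvd_zero p)
  let s : ZMod N := (p ^ n * m : ℕ)
  have hs : s ≠ 0 := by
    rw [Ne, ZMod.natCast_eq_zero_iff]
    intro hd
    have := Nat.le_of_dvd (by have := hp.pos; positivity) hd
    have h2 : p ^ n * m * 2 ≤ N := by
      rw [hN, pow_succ]; nlinarith [hp.two_le, Nat.zero_le (p ^ n * m)]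
    have : 0 < p ^ n * m := by have := hp.pos; positivity
    omega
  have hord (k : ZMod N) (hk : s * k ≠ 0) : addOrderOf ((m : ZMod N) * k) = p ^ (n + 1) := by
    have := Fact.mk hp
    refine addOrderOf_eq_prime_pow ?_ ?_
    · rw [nsmul_eq_mul, ← mul_assoc, ← Nat.cast_mul]
      exact hk
    · rw [nsmul_eq_mul, ← mul_assoc, ← Nat.cast_mul, ← hN]
      simp
  have hb : Function.Bijective fun x : Ω × T => (x.1 : ZMod N) + m • (x.2 : ZMod N) := by
    have := bijective_smul_add (f := fun x : T => (x : ZMod N)) (h := fun x : Ω => (x : ZMod N))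
      (by simpa only [add_comm, Function.comp_def, Equiv.prodComm_apply, Prod.fst_swap,
        Prod.snd_swap] using Function.Bijective.comp h (Equiv.prodComm T Ω).bijective)
      (m := m) ?_ hm0
    · simpa only [add_comm, Function.comp_def, Equiv.prodComm_apply, Prod.fst_swap,
        Prod.snd_swap] using this.comp (Equiv.prodComm Ω T).bijective
    · rw [← Nat.card_eq_fintype_card, hT]
      exact ((Nat.Prime.coprime_iff_not_dvd hp).2 hm).symm.pow_right a
  by_cases hv : ∃ k, s * k ≠ 0 ∧ ∑ t : T, ZMod.stdAddChar (m • (t : ZMod N) * k) = (0 : ℂ)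
  · right
    obtain ⟨k, hk, hkT⟩ := hv
    let T' : Set (ZMod N) := Set.range fun t : T => m • (t : ZMod N)
    have hinj : Function.Injective fun t : T => m • (t : ZMod N) := by
      obtain ⟨w, hw⟩ := h.nonempty_left
      intro t t' htt
      exact (Prod.mk.inj (@hb.1 (⟨w, hw⟩, t) (⟨w, hw⟩, t') (congrArg (w + ·) htt))).2
    have := Fintype.ofFinite T'
    let e : T ≃ T' := Equiv.ofInjective _ hinj
    refine ⟨T', isPeriodicSet_of_forall_add_mem (s := s) ?_ hs
      (add_mem_of_sum_stdAddChar_eq_zero fun l hl => ?_), ?_⟩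
    · exact (h.nonempty_right.image _).mono (by rintro _ ⟨t, ht, rfl⟩; exact ⟨⟨t, ht⟩, rfl⟩)
    · rw [← e.sum_comp fun a => ZMod.stdAddChar ((a : ZMod N) * l)]
      have hmul (x y : ZMod N) : m • x * y = x * (m * y) := by rw [nsmul_eq_mul]; ring
      simp only [T', e, Equiv.ofInjective_apply, hmul] at hkT ⊢
      exact sum_stdAddChar_eq_zero_of_addOrderOf_eq _ ((hord k hk).trans (hord l hl).symm) hkT
    · have := hb.comp ((Equiv.refl Ω).prodCongr e.symm).bijective
      change Function.Bijective _
      convert this using 2 with x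
      exact congrArg (_ + ·) (Equiv.apply_ofInjective_symm hinj x.2).symm
  · left
    push Not at hv
    refine isPeriodicSet_of_forall_add_mem h.nonempty_left hs
      (add_mem_of_sum_stdAddChar_eq_zero fun l hl => ?_)
    have := sum_stdAddChar_mul_sum_stdAddChar (f := fun x : Ω => (x : ZMod N))
      (h := fun x : T => m • (x : ZMod N)) hb (right_ne_zero_of_mul hl)
    exact (mul_eq_zero.1 this).resolve_right (hv l hl)

/-! ### Cyclic groups of order `p²q²` -/

/-- A set invariant under a translation of prime order `p` is a union of cosets of size `p`. -/
theorem dvd_card_of_forall_add_mem {G : Type*} [AddCommGroup G] [Finite G] {A : Set G} {p : ℕ}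
    (hp : p.Prime) {s : G} (hs : addOrderOf s = p) (h : ∀ x ∈ A, x + s ∈ A) : p ∣ Nat.card A := by
  classical
  have := Fact.mk hp
  have := Fintype.ofFinite A
  let f : Function.End A := fun x => ⟨x + s, h x x.2⟩
  have hf (n : ℕ) (x : A) : ((f ^ n) x : G) = x + n • s := by
    induction n with
    | zero => rw [pow_zero, zero_smul, add_zero]; rfl
    | succ n ih =>
      rw [pow_succ']
      change ((f ^ n) x : G) + s = _
      rw [ih, succ_nsmul, add_assoc]
  have hfp : f ^ p ^ 1 = 1 := by
    refine funext fun x => Subtype.ext ?_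
    rw [hf, pow_one, ← hs, addOrderOf_nsmul_eq_zero, add_zero]
    rfl
  have hmod := Equiv.Perm.card_fixedPoints_modEq hfp
  have hempty : IsEmpty (Function.fixedPoints f) := by
    refine ⟨fun x => ?_⟩
    have : (x : G) + s = x := congrArg Subtype.val x.2
    rw [add_eq_left] at this
    rw [this, addOrderOf_zero] at hs
    exact hp.one_lt.ne hs
  rw [Nat.card_eq_fintype_card]
  simpa [Nat.modEq_zero_iff_dvd] using hmod

/-- Let `s` and `t` have distinct prime orders `p` and `q`, and suppose that the mixed differences
of the indicator function of `A` along `⟨s⟩` and `⟨t⟩` vanish. Then `A` is the disjoint union of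
cosets of `⟨s⟩` and cosets of `⟨t⟩`; if `|A| = pq`, divisibility leaves only one of the two
kinds. -/
theorem isPeriodicSet_of_indicator_add_indicator {G : Type*} [AddCommGroup G] [Finite G]
    {A : Set G} {p q : ℕ} (hp : p.Prime) (hq : q.Prime) (hpq : p ≠ q) {s t : G}
    (hs : addOrderOf s = p) (ht : addOrderOf t = q) (hA : Nat.card A = p * q)
    (h : ∀ (x : G) (i : ℕ), A.indicator (1 : G → ℂ) x + A.indicator 1 (x + i • s + t) =
      A.indicator 1 (x + i • s) + A.indicator 1 (x + t)) : IsPeriodicSet A := by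
  have hs0 : s ≠ 0 := by rintro rfl; exact hp.one_lt.ne (by simpa using hs)
  have ht0 : t ≠ 0 := by rintro rfl; exact hq.one_lt.ne (by simpa using ht)
  have hne : A.Nonempty := by
    rw [← Set.nonempty_coe_sort]
    exact (Nat.card_pos_iff.1 (hA ▸ Nat.mul_pos hp.pos hq.pos)).1
  let A₁ : Set G := {x | x ∈ A ∧ ∀ i : ℕ, x + i • s ∈ A}
  have h₁A : A₁ ⊆ A := fun x hx => hx.1
  have h₁ : ∀ x ∈ A₁, x + s ∈ A₁ := fun x hx =>
    ⟨by simpa using hx.2 1, fun i => by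
      have := hx.2 (i + 1)
      rwa [add_assoc, ← succ_nsmul']⟩
  have h₂ : ∀ x ∈ A \ A₁, x + t ∈ A \ A₁ := by
    rintro x ⟨hx, hx₁⟩
    have : ∃ i : ℕ, x + i • s ∉ A := by simpa [A₁, hx] using hx₁
    obtain ⟨i, hi⟩ := this
    have key := h x i
    by_cases ha : x + i • s + t ∈ A <;> by_cases hb : x + t ∈ A
    · simp [hx, hi, ha, hb] at key
    · norm_num [hx, hi, ha, hb] at key
    · exact ⟨hb, fun hc => ha (by simpa [add_right_comm] using hc.2 i)⟩
    · simp [hx, hi, ha, hb] at key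
  have hd₁ := dvd_card_of_forall_add_mem hp hs h₁
  have hd₂ := dvd_card_of_forall_add_mem hq ht h₂
  have hsum : (A \ A₁).ncard + A₁.ncard = p * q := by
    rw [Set.ncard_sdiff_add_ncard_of_subset h₁A, ← hA, Nat.card_coe_set_eq]
  rw [Nat.card_coe_set_eq] at hd₁ hd₂
  have hpd₂ : p ∣ (A \ A₁).ncard := (Nat.dvd_add_left hd₁).1 (hsum ▸ dvd_mul_right p q)
  have hpqd := ((Nat.coprime_primes hp hq).2 hpq).mul_dvd_of_dvd_of_dvd hpd₂ hd₂
  obtain h0 | hpos := Nat.eq_zero_or_pos (A \ A₁).ncard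
  · have hAA : A ⊆ A₁ := Set.sdiff_eq_empty.1 ((Set.ncard_eq_zero).1 h0)
    exact isPeriodicSet_of_forall_add_mem hne hs0 fun x hx => h₁A (h₁ x (hAA hx))
  · have hle := Nat.le_of_dvd hpos hpqd
    have h0 : A₁ = ∅ := (Set.ncard_eq_zero).1 (by omega)
    rw [h0, Set.sdiff_empty] at h₂
    exact isPeriodicSet_of_forall_add_mem hne ht0 h₂

theorem isPeriodicSet_of_sum_stdAddChar_eq_zero {N p q : ℕ} [NeZero N] (hp : p.Prime)
    (hq : q.Prime) (hpq : p ≠ q) (hN : N = p ^ 2 * q ^ 2) {A : Set (ZMod N)}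
    [Fintype A] (hA : Nat.card A = p * q)
    (h : ∀ k : ZMod N, addOrderOf k = N → ∑ a : A, ZMod.stdAddChar ((a : ZMod N) * k) = (0 : ℂ)) :
    IsPeriodicSet A := by
  have hord (c d : ℕ) (hcd : N = c * d) : addOrderOf ((c : ℕ) : ZMod N) = d := by
    have hc : c ≠ 0 := by rintro rfl; exact NeZero.ne N (by simpa using hcd)
    rw [ZMod.addOrderOf_coe _ (NeZero.ne N), hcd, Nat.gcd_eq_right (dvd_mul_right c d),
      Nat.mul_div_cancel_left _ (Nat.pos_of_ne_zero hc)]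
  have hfull (k : ZMod N) (hs : ((p * q ^ 2 : ℕ) : ZMod N) * k ≠ 0)
      (ht : ((p ^ 2 * q : ℕ) : ZMod N) * k ≠ 0) : addOrderOf k = N := by
    refine addOrderOf_eq_of_nsmul_and_div_prime_nsmul (NeZero.pos N) (by simp) fun r hr hrN => ?_
    rw [hN, hr.dvd_mul] at hrN
    rcases hrN with hrp | hrq
    · rw [(Nat.prime_dvd_prime_iff_eq hr hp).1 (hr.dvd_of_dvd_pow hrp),
        show N / p = p * q ^ 2 from Nat.div_eq_of_eq_mul_right hp.pos (by rw [hN]; ring)]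
      simpa [nsmul_eq_mul] using hs
    · rw [(Nat.prime_dvd_prime_iff_eq hr hq).1 (hr.dvd_of_dvd_pow hrq),
        show N / q = p ^ 2 * q from Nat.div_eq_of_eq_mul_right hq.pos (by rw [hN]; ring)]
      simpa [nsmul_eq_mul] using ht
  refine isPeriodicSet_of_indicator_add_indicator hp hq hpq
    (hord (p * q ^ 2) p (by rw [hN]; ring)) (hord (p ^ 2 * q) q (by rw [hN]; ring)) hA
    fun x i => indicator_add_indicator_of_sum_stdAddChar_eq_zero
      (fun k hs ht => h k (hfull k ?_ ht)) x
  intro h0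
  rw [nsmul_eq_mul, mul_assoc, h0, mul_zero] at hs
  exact hs rfl

theorem IsTilingPair.periodic_of_card_eq_mul {N p q : ℕ} [NeZero N] (hp : p.Prime)
    (hq : q.Prime) (hpq : p ≠ q) (hN : N = p ^ 2 * q ^ 2) {Ω T : Set (ZMod N)}
    (h : IsTilingPair Ω T) (hΩ : Nat.card Ω = p * q) : IsPeriodicSet Ω ∨ IsPeriodicSet T := by
  have := Fintype.ofFinite Ω
  have := Fintype.ofFinite T
  have hT : Nat.card T = p * q := by
    have := h.card_mul
    rw [Nat.card_zmod, hΩ] at this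
    exact Nat.eq_of_mul_eq_mul_left (Nat.mul_pos hp.pos hq.pos) (by rw [this, hN]; ring)
  have h1 : addOrderOf (1 : ZMod N) = N := ZMod.addOrderOf_one N
  have h10 : (1 : ZMod N) ≠ 0 := by
    intro h0
    rw [h0, addOrderOf_zero] at h1
    nlinarith [hp.two_le, hq.two_le, Nat.mul_le_mul hp.two_le hq.two_le]
  refine (mul_eq_zero.1 (sum_stdAddChar_mul_sum_stdAddChar h h10)).imp (fun h0 => ?_) fun h0 => ?_
  · exact isPeriodicSet_of_sum_stdAddChar_eq_zero hp hq hpq hN hΩ fun k hk =>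
      sum_stdAddChar_eq_zero_of_addOrderOf_eq _ (h1.trans hk.symm) h0
  · exact isPeriodicSet_of_sum_stdAddChar_eq_zero hp hq hpq hN hT fun k hk =>
      sum_stdAddChar_eq_zero_of_addOrderOf_eq _ (h1.trans hk.symm) h0

/-! ### Two complements of one set in the product of two primary torsion subgroups -/

/-- The subgroup of elements annihilated by `n`. -/
def nsmulKer (G : Type*) [AddCommGroup G] (n : ℕ) : AddSubgroup G :=
  (nsmulAddMonoidHom n : G →+ G).ker

theorem mem_nsmulKer {G : Type*} [AddCommGroup G] {n : ℕ} {g : G} :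
    g ∈ nsmulKer G n ↔ n • g = 0 := Iff.rfl

theorem nsmulKer_mono {G : Type*} [AddCommGroup G] {m n : ℕ} (h : m ∣ n) :
    nsmulKer G m ≤ nsmulKer G n := by
  obtain ⟨c, rfl⟩ := h
  intro g hg
  rw [mem_nsmulKer] at hg ⊢
  rw [mul_comm, mul_smul, hg, smul_zero]

theorem eq_zero_of_coprime_of_mem_nsmulKer {G : Type*} [AddCommGroup G] {m n : ℕ}
    (h : m.Coprime n) {g : G} (hm : g ∈ nsmulKer G m) (hn : g ∈ nsmulKer G n) : g = 0 := by
  rw [← AddMonoid.addOrderOf_eq_one_iff, ← Nat.dvd_one, ← h.gcd_eq_one]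
  exact Nat.dvd_gcd (addOrderOf_dvd_of_nsmul_eq_zero hm) (addOrderOf_dvd_of_nsmul_eq_zero hn)

theorem exists_add_eq_of_mem_nsmulKer_mul {G : Type*} [AddCommGroup G] {m n : ℕ}
    (h : m.Coprime n) {g : G} (hg : g ∈ nsmulKer G (m * n)) :
    ∃ x ∈ nsmulKer G m, ∃ y ∈ nsmulKer G n, x + y = g := by
  have hbez := Nat.gcd_eq_gcd_ab m n
  rw [h.gcd_eq_one] at hbez
  have hg' : (m * n) • g = 0 := hg
  refine ⟨(n * Nat.gcdB m n : ℤ) • g, ?_, (m * Nat.gcdA m n : ℤ) • g, ?_, ?_⟩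
  · rw [mem_nsmulKer, ← natCast_zsmul, smul_smul, ← mul_assoc, mul_comm, mul_smul, ← Nat.cast_mul,
      natCast_zsmul, hg', smul_zero]
  · rw [mem_nsmulKer, ← natCast_zsmul, smul_smul, ← mul_assoc, mul_comm, mul_smul, ← Nat.cast_mul,
      natCast_zsmul, mul_comm, hg', smul_zero]
  · rw [← add_smul, add_comm, ← hbez, Nat.cast_one, one_smul]

/-- The sum of the elements annihilated by `m` and of those annihilated by `n` is direct. -/
theorem eq_and_eq_of_add_eq_add {G : Type*} [AddCommGroup G] {m n : ℕ} (h : m.Coprime n)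
    {x y x' y' : G} (hx : x ∈ nsmulKer G m) (hy : y ∈ nsmulKer G n) (hx' : x' ∈ nsmulKer G m)
    (hy' : y' ∈ nsmulKer G n) (he : x + y = x' + y') : x = x' ∧ y = y' := by
  have h1 : x - x' = y' - y := by rw [sub_eq_sub_iff_add_eq_add, he, add_comm]
  have h2 : x - x' = 0 :=
    eq_zero_of_coprime_of_mem_nsmulKer h (sub_mem hx hx') (h1 ▸ sub_mem hy' hy)
  exact ⟨sub_eq_zero.1 h2, (sub_eq_zero.1 (h1 ▸ h2)).symm⟩

/-- The set of sums `(x + f y) + y` with `x ∈ P` and `y ∈ Q`: a shear of `P + Q`. -/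
def shearedSum {G : Type*} [AddCommGroup G] (P Q : AddSubgroup G) (f : G → G) : Set G :=
  {g | ∃ x ∈ P, ∃ y ∈ Q, x + f y + y = g}

/-- If `S` and `S'` are transversals of the elements annihilated by `m` among those annihilated by
`m²`, and likewise for `n`, then `S + S'` is a complement of each sheared sum: the second
coordinate determines `y`, and then the first one determines `x`. -/
theorem bijOn_shearedSum {G : Type*} [AddCommGroup G] {m n : ℕ}
    (h : (m ^ 2).Coprime (n ^ 2)) {S S' : Set G} (hSm : S ⊆ nsmulKer G (m ^ 2))
    (hSn : S' ⊆ nsmulKer G (n ^ 2))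
    (hS : Set.BijOn (fun x : G × G => x.1 + x.2) ((nsmulKer G m : Set G) ×ˢ S)
      (nsmulKer G (m ^ 2)))
    (hS' : Set.BijOn (fun x : G × G => x.1 + x.2) ((nsmulKer G n : Set G) ×ˢ S')
      (nsmulKer G (n ^ 2)))
    {f : G → G} (hf : ∀ y, f y ∈ nsmulKer G (m ^ 2)) :
    Set.BijOn (fun x : G × G => x.1 + x.2)
      (shearedSum (nsmulKer G m) (nsmulKer G n) f ×ˢ {g | ∃ t ∈ S, ∃ t' ∈ S', t + t' = g})
      (nsmulKer G (m ^ 2 * n ^ 2)) := by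
  have hm : nsmulKer G m ≤ nsmulKer G (m ^ 2) := nsmulKer_mono (dvd_pow_self m two_ne_zero)
  have hn : nsmulKer G n ≤ nsmulKer G (n ^ 2) := nsmulKer_mono (dvd_pow_self n two_ne_zero)
  refine ⟨?_, ?_, ?_⟩
  · rintro ⟨_, _⟩ ⟨⟨x, hx, y, hy, rfl⟩, ⟨t, ht, t', ht', rfl⟩⟩
    have h1 := nsmulKer_mono (dvd_mul_right (m ^ 2) (n ^ 2))
      (add_mem (add_mem (hm hx) (hf y)) (hSm ht))
    have h2 := nsmulKer_mono (dvd_mul_left (n ^ 2) (m ^ 2)) (add_mem (hn hy) (hSn ht'))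
    have h3 := add_mem h1 h2
    rwa [add_add_add_comm] at h3
  · rintro ⟨_, _⟩ ⟨⟨x, hx, y, hy, rfl⟩, ⟨t, ht, t', ht', rfl⟩⟩ ⟨_, _⟩
      ⟨⟨u, hu, v, hv, rfl⟩, ⟨r, hr, r', hr', rfl⟩⟩ he
    have he : x + f y + t + (y + t') = u + f v + r + (v + r') := by
      calc _ = x + f y + y + (t + t') := by abel
        _ = u + f v + v + (r + r') := he
        _ = _ := by abel
    obtain ⟨h1, h2⟩ := eq_and_eq_of_add_eq_add h (add_mem (add_mem (hm hx) (hf y)) (hSm ht))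
      (add_mem (hn hy) (hSn ht')) (add_mem (add_mem (hm hu) (hf v)) (hSm hr))
      (add_mem (hn hv) (hSn hr')) he
    have h3 := hS'.injOn (x₁ := (y, t')) (x₂ := (v, r')) ⟨hy, ht'⟩ ⟨hv, hr'⟩ h2
    obtain ⟨rfl, rfl⟩ := Prod.mk.inj h3
    rw [add_right_comm x, add_right_comm u, add_left_inj] at h1
    have h4 := hS.injOn (x₁ := (x, t)) (x₂ := (u, r)) ⟨hx, ht⟩ ⟨hu, hr⟩ h1
    obtain ⟨rfl, rfl⟩ := Prod.mk.inj h4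
    rfl
  · intro g hg
    obtain ⟨x, hx, y, hy, rfl⟩ := exists_add_eq_of_mem_nsmulKer_mul h hg
    obtain ⟨⟨v, t'⟩, ⟨hv, ht'⟩, hvt⟩ := hS'.surjOn hy
    obtain ⟨⟨u, t⟩, ⟨hu, ht⟩, hut⟩ := hS.surjOn (sub_mem hx (hf v))
    refine ⟨(_, _), ⟨⟨u, hu, v, hv, rfl⟩, ⟨t, ht, t', ht', rfl⟩⟩, ?_⟩
    have hut : u + t = x - f v := hut
    have hvt : v + t' = y := hvt
    change u + f v + v + (t + t') = x + y
    rw [← hvt, eq_add_of_sub_eq hut.symm]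
    abel

theorem exists_bijOn_nsmulKer {G : Type*} [AddCommGroup G] {m n : ℕ} (h : m ∣ n) :
    ∃ S : Set G, S ⊆ nsmulKer G n ∧
      Set.BijOn (fun x : G × G => x.1 + x.2) ((nsmulKer G m : Set G) ×ˢ S) (nsmulKer G n) := by
  obtain ⟨S, hS, -⟩ := (nsmulKer G m).exists_isComplement_right 0
  have hle := nsmulKer_mono (G := G) h
  refine ⟨S ∩ nsmulKer G n, Set.inter_subset_right, ?_, ?_, fun g hg => ?_⟩
  · rintro ⟨x, t⟩ ⟨hx, ht⟩
    exact add_mem (hle hx) ht.2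
  · rintro ⟨x, t⟩ ⟨hx, ht⟩ ⟨x', t'⟩ ⟨hx', ht'⟩ he
    have := @hS.1 (⟨x, hx⟩, ⟨t, ht.1⟩) (⟨x', hx'⟩, ⟨t', ht'.1⟩) he
    simpa only [Prod.mk.injEq, Subtype.mk.injEq] using this
  · obtain ⟨⟨x, t⟩, hxt⟩ := hS.2 g
    have hxt' : (x : G) + t = g := hxt
    refine ⟨(x, t), ⟨x.2, t.2, ?_⟩, hxt'⟩
    rw [← hxt'] at hg
    exact ((nsmulKer G n).add_mem_cancel_left (hle x.2)).1 hg

/-- Let `a` and `b` be annihilated by `p²` and `q²`, but not by `p` and `q`. Shear the sum of the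
subgroups `P` and `Q` annihilated by `p` and `q` once along `a` and once along `b`, fixing `P` and
`Q`, respectively. The two sets have a common complement `T` in the subgroup annihilated by `p²q²`;
they intersect in `0` only, and the latter contains no translate of the former, since it contains no
coset of `P`. -/
theorem exists_pair_of_complements {G : Type*} [AddCommGroup G] {p q : ℕ} (hpq : p.Coprime q)
    {a b : G} (ha : a ∈ nsmulKer G (p ^ 2)) (ha' : a ∉ nsmulKer G p)
    (hb : b ∈ nsmulKer G (q ^ 2)) (hb' : b ∉ nsmulKer G q) :
    ∃ U₁ U₂ T : Set G,
      Set.BijOn (fun x : G × G => x.1 + x.2) (U₁ ×ˢ T) (nsmulKer G (p ^ 2 * q ^ 2)) ∧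
      Set.BijOn (fun x : G × G => x.1 + x.2) (U₂ ×ˢ T) (nsmulKer G (p ^ 2 * q ^ 2)) ∧
      T ⊆ nsmulKer G (p ^ 2 * q ^ 2) ∧ (nsmulKer G p : Set G) ⊆ U₁ ∧
      (nsmulKer G q : Set G) ⊆ U₂ ∧ (∀ u ∈ U₁, u ∈ U₂ → u = 0) ∧
      ∀ k, ∃ u ∈ U₁, u + k ∉ U₂ := by
  classical
  have hcop : (p ^ 2).Coprime (q ^ 2) := hpq.pow 2 2
  obtain ⟨S, hS, hSb⟩ := exists_bijOn_nsmulKer (G := G) (dvd_pow_self p two_ne_zero)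
  obtain ⟨S', hS', hSb'⟩ := exists_bijOn_nsmulKer (G := G) (dvd_pow_self q two_ne_zero)
  have hP : nsmulKer G p ≤ nsmulKer G (p ^ 2) := nsmulKer_mono (dvd_pow_self p two_ne_zero)
  have hQ : nsmulKer G q ≤ nsmulKer G (q ^ 2) := nsmulKer_mono (dvd_pow_self q two_ne_zero)
  let σ : G → G := fun y => if y = 0 then 0 else a
  let τ : G → G := fun x => if x = 0 then 0 else b
  have hσ (y : G) : σ y ∈ nsmulKer G (p ^ 2) := by
    dsimp only [σ]
    split_ifs
    exacts [zero_mem _, ha]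
  have hτ (y : G) : τ y ∈ nsmulKer G (q ^ 2) := by
    dsimp only [τ]
    split_ifs
    exacts [zero_mem _, hb]
  have hσP {y : G} (h : σ y ∈ nsmulKer G p) : y = 0 := by
    by_contra hy
    exact ha' (by simpa [σ, hy] using h)
  have hτQ {x : G} (h : τ x ∈ nsmulKer G q) : x = 0 := by
    by_contra hx
    exact hb' (by simpa [τ, hx] using h)
  have hT₁ := bijOn_shearedSum hcop hS hS' hSb hSb' hσ
  have hT₂ := bijOn_shearedSum hcop.symm hS' hS hSb' hSb hτ
  have hTcomm : {g | ∃ t ∈ S', ∃ t' ∈ S, t + t' = g} = {g | ∃ t ∈ S, ∃ t' ∈ S', t + t' = g} := by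
    ext g
    constructor <;> exact fun ⟨t, ht, t', ht', h⟩ => ⟨t', ht', t, ht, by rw [add_comm, h]⟩
  rw [hTcomm, mul_comm] at hT₂
  refine ⟨_, _, _, hT₁, hT₂, ?_, ?_, ?_, ?_, ?_⟩
  · rintro _ ⟨t, ht, t', ht', rfl⟩
    exact add_mem (nsmulKer_mono (dvd_mul_right _ _) (hS ht))
      (nsmulKer_mono (dvd_mul_left _ _) (hS' ht'))
  · exact fun x hx => ⟨x, hx, 0, zero_mem _, by simp [σ]⟩
  · exact fun y hy => ⟨y, hy, 0, zero_mem _, by simp [τ]⟩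
  · rintro _ ⟨x, hx, y, hy, rfl⟩ ⟨y', hy', x', hx', h⟩
    obtain ⟨h2, h1⟩ := eq_and_eq_of_add_eq_add hcop.symm (add_mem (hQ hy') (hτ x')) (hP hx')
      (hQ hy) (add_mem (hP hx) (hσ y)) (by rw [h, add_comm])
    have hy0 : y = 0 := hσP (by
      rw [show σ y = x' - x by rw [h1]; abel]
      exact sub_mem hx' hx)
    have hx0 : x' = 0 := hτQ (by
      rw [show τ x' = y - y' by rw [← h2]; abel]
      exact sub_mem hy hy')
    rw [← h1, hx0, hy0, add_zero]
  · intro k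
    by_contra! hk
    have hPk : ∀ x ∈ nsmulKer G p, x + k ∈ shearedSum (nsmulKer G q) (nsmulKer G p) τ :=
      fun x hx => hk x ⟨x, hx, 0, zero_mem _, by simp [σ]⟩
    obtain ⟨y₁, hy₁, x₁, hx₁, h1⟩ := hPk 0 (zero_mem _)
    have hτk : ∀ x ∈ nsmulKer G p, τ x - τ x₁ ∈ nsmulKer G q := by
      intro x hx
      obtain ⟨y₂, hy₂, x₂, hx₂, h2⟩ := hPk (x - x₁) (sub_mem hx hx₁)
      obtain ⟨h3, rfl⟩ := eq_and_eq_of_add_eq_add hcop.symm (add_mem (hQ hy₂) (hτ x₂)) (hP hx₂)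
        (add_mem (hQ hy₁) (hτ x₁)) (hP hx) (by rw [h2, ← zero_add k, ← h1]; abel)
      rw [show τ x₂ - τ x₁ = y₁ - y₂ by
        rw [sub_eq_sub_iff_add_eq_add, add_comm, h3, add_comm]]
      exact sub_mem hy₁ hy₂
    have hx₁0 : x₁ = 0 := hτQ (by simpa [τ] using hτk 0 (zero_mem _))
    have hpa : p • a ∈ nsmulKer G p := by
      rw [mem_nsmulKer, smul_smul, ← pow_two]
      exact ha
    refine ha' (hτQ (x := p • a) ?_)
    have := hτk _ hpa
    rwa [hx₁0, show τ 0 = 0 from if_pos rfl, sub_zero] at this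

/-! ### An aperiodic tile without periodic complements -/

/-- Complements of `T` in `K`, one for each coset of `K`, may be transported to the cosets along
representatives, and make up a complement of `T` in `G`. -/
theorem isTilingPair_of_bijOn {G : Type*} [AddCommGroup G] {K : AddSubgroup G} {T : Set G}
    {U : G ⧸ K → Set G} (hTK : T ⊆ K)
    (hU : ∀ c, Set.BijOn (fun x : G × G => x.1 + x.2) (U c ×ˢ T) K)
    {s : G ⧸ K → G} (hs : ∀ c, (s c : G ⧸ K) = c) :
    IsTilingPair {g : G | g - s g ∈ U g} T := by
  have hmk {g k : G} (hk : k ∈ K) : ((g + k : G) : G ⧸ K) = g :=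
    QuotientAddGroup.mk_add_of_mem g hk
  refine ⟨?_, fun g => ?_⟩
  · rintro ⟨⟨w, hw⟩, ⟨t, ht⟩⟩ ⟨⟨w', hw'⟩, ⟨t', ht'⟩⟩ h
    have h : w + t = w' + t' := h
    have hc : (w : G ⧸ K) = w' := by rw [← hmk (hTK ht), h, hmk (hTK ht')]
    have hw' : w' - s w' ∈ U w' := hw'
    rw [← hc] at hw'
    have he := (hU w).injOn (x₁ := (_, t)) (x₂ := (_, t')) ⟨hw, ht⟩ ⟨hw', ht'⟩
      (by change w - s w + t = w' - s w + t'; rw [sub_add_eq_add_sub, sub_add_eq_add_sub, h])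
    obtain ⟨h1, rfl⟩ := Prod.mk.inj he
    obtain rfl := sub_left_injective h1
    rfl
  · have hgK : g - s g ∈ K := by
      rw [← QuotientAddGroup.eq_zero_iff, QuotientAddGroup.mk_sub, hs, sub_self]
    obtain ⟨⟨u, t⟩, ⟨hu, ht⟩, hut⟩ := (hU g).surjOn hgK
    have hut : u + t = g - s g := hut
    have huK : u ∈ K := (K.add_mem_cancel_right (hTK ht)).1 (hut ▸ hgK)
    refine ⟨(⟨s g + u, ?_⟩, ⟨t, ht⟩), ?_⟩
    · change s g + u - s _ ∈ U _
      rw [hmk huK, hs]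
      simpa using hu
    · change s g + u + t = g
      rw [add_assoc, hut]
      abel

/-- The cosets of the subgroup annihilated by `m` have representatives that include all elements of
order prime to `m`, as no coset contains two of these. -/
theorem exists_section_of_coprime (G : Type*) [AddCommGroup G] (m : ℕ) :
    ∃ s : G ⧸ nsmulKer G m → G, (∀ c, (s c : G ⧸ nsmulKer G m) = c) ∧
      ∀ (h : G) (n : ℕ), n.Coprime m → n • h = 0 → s h = h := by
  have hsec (c : G ⧸ nsmulKer G m) : ∃ g : G, (g : G ⧸ nsmulKer G m) = c ∧
      ∀ h : G, (h : G ⧸ nsmulKer G m) = c → ∀ n : ℕ, n.Coprime m → n • h = 0 → g = h := by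
    by_cases hex : ∃ h : G, (h : G ⧸ nsmulKer G m) = c ∧ ∃ n : ℕ, n.Coprime m ∧ n • h = 0
    · obtain ⟨g, hg, n, hn, hng⟩ := hex
      refine ⟨g, hg, fun h hh l hl hlh => sub_eq_zero.1
        (eq_zero_of_coprime_of_mem_nsmulKer (hn.mul_left hl) (sub_mem ?_ ?_) ?_)⟩
      · exact nsmulKer_mono (dvd_mul_right n l) hng
      · exact nsmulKer_mono (dvd_mul_left l n) hlh
      · rw [← QuotientAddGroup.eq_zero_iff, QuotientAddGroup.mk_sub, hg, hh, sub_self]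
    · obtain ⟨g, hg⟩ := QuotientAddGroup.mk_surjective c
      exact ⟨g, hg, fun h hh n hn hnh => absurd ⟨h, hh, n, hn, hnh⟩ hex⟩
  choose s hs hs' using hsec
  exact ⟨s, hs, fun h n hn hnh => hs' _ h rfl n hn hnh⟩

/-- Some prime multiple of a nonzero period is a period again. If the differences of a tile contain
all elements of prime order, then they contain this period, and the complement cannot have it. -/
theorem IsTilingPair.not_isPeriodicSet_of_forall_prime {G : Type*} [AddCommGroup G] [Finite G]
    {Ω T : Set G} (h : IsTilingPair Ω T)
    (hd : ∀ r : ℕ, r.Prime → ∀ x : G, x ≠ 0 → r • x = 0 → ∃ w ∈ Ω, w + x ∈ Ω) :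
    ¬ IsPeriodicSet T := by
  rintro ⟨⟨t, ht⟩, g, hg, hgT⟩
  have hadd (n : ℕ) : t + n • g ∈ T := by
    induction n with
    | zero => simpa
    | succ n ih =>
      rw [succ_nsmul, ← add_assoc]
      exact hgT ▸ ⟨_, ih, rfl⟩
  obtain ⟨r, hr, d, hrd⟩ := Nat.exists_prime_and_dvd
    (fun h => hg (AddMonoid.addOrderOf_eq_one_iff.1 h) : addOrderOf g ≠ 1)
  have hpos := addOrderOf_pos g
  have hd0 : d • g ≠ 0 := by
    intro h0
    have hdpos : 0 < d := Nat.pos_of_ne_zero (by rintro rfl; omega)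
    have := Nat.le_of_dvd hdpos (addOrderOf_dvd_of_nsmul_eq_zero h0)
    have := hr.two_le
    nlinarith
  obtain ⟨w, hw, hw'⟩ := hd r hr (d • g) hd0 (by rw [smul_smul, ← hrd, addOrderOf_nsmul_eq_zero])
  have := @h.1 (⟨w, hw⟩, ⟨t + d • g, hadd d⟩) (⟨w + d • g, hw'⟩, ⟨t, ht⟩)
    (by change w + (t + d • g) = w + d • g + t; abel)
  simp only [Prod.mk.injEq, Subtype.mk.injEq] at this
  exact hd0 (by simpa using this.1.symm)

/-- Let `K` be the subgroup annihilated by `p²q²`, a proper subgroup, and let `U₁` and `U₂` be the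
sets of `exists_pair_of_complements`, with the common complement `T`. The tile consists of `U₁` in
`K` and of translates of `U₂` in the other cosets of `K`. It is aperiodic: a period in `K` lies in
both `U₁` and `U₂`, and any other period carries `U₁` to a translate of `U₂`. Its differences
contain the elements of order `p` (from `U₁`), those of order `q` (from `U₂`) and those of other
prime orders (from the choice of translates). -/
theorem not_hasPTProperty_of_nsmul_ne_zero {G : Type*} [AddCommGroup G] [Finite G] {p q : ℕ}
    (hp : p.Prime) (hq : q.Prime) (hpq : p ≠ q) {a b g₀ : G} (ha : p ^ 2 • a = 0)
    (ha' : p • a ≠ 0) (hb : q ^ 2 • b = 0) (hb' : q • b ≠ 0) (hg₀ : (p ^ 2 * q ^ 2) • g₀ ≠ 0) :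
    ¬ HasPTProperty G := by
  classical
  obtain ⟨U₁, U₂, T, hT₁, hT₂, hTK, hPU₁, hQU₂, hU₁U₂, hshift⟩ :=
    exists_pair_of_complements ((Nat.coprime_primes hp hq).2 hpq) ha ha' hb hb'
  set K := nsmulKer G (p ^ 2 * q ^ 2)
  obtain ⟨s, hs, hs'⟩ : ∃ s : G ⧸ K → G, (∀ c, (s c : G ⧸ K) = c) ∧
      ∀ (h : G) (n : ℕ), n.Coprime (p ^ 2 * q ^ 2) → n • h = 0 → s h = h :=
    exists_section_of_coprime G (p ^ 2 * q ^ 2)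
  have hs0 : s 0 = 0 := hs' 0 1 (Nat.coprime_one_left _) (smul_zero _)
  let U : G ⧸ K → Set G := fun c => if c = 0 then U₁ else U₂
  have hU0 : U 0 = U₁ := if_pos rfl
  have hU {c : G ⧸ K} (hc : c ≠ 0) : U c = U₂ := if_neg hc
  have htile : IsTilingPair {g : G | g - s g ∈ U g} T := by
    refine isTilingPair_of_bijOn hTK (fun c => ?_) hs
    by_cases hc : c = 0
    · rwa [hc, hU0]
    · rwa [hU hc]
  set Ω : Set G := {g : G | g - s g ∈ U g}
  have hmk {g k : G} (hk : k ∈ K) : ((g + k : G) : G ⧸ K) = g :=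
    QuotientAddGroup.mk_add_of_mem g hk
  have hΩ {g k : G} (hk : k ∈ K) : g + k ∈ Ω ↔ g + k - s g ∈ U g := by
    change g + k - s ((g + k : G) : G ⧸ K) ∈ U ((g + k : G) : G ⧸ K) ↔ _
    rw [hmk hk]
  have hΩ₁ {k : G} (hk : k ∈ K) : k ∈ Ω ↔ k ∈ U₁ := by
    have := hΩ (g := 0) hk
    rwa [zero_add, QuotientAddGroup.mk_zero, hs0, sub_zero, hU0] at this
  have hΩ₂ {c : G ⧸ K} (hc : c ≠ 0) {k : G} (hk : k ∈ K) : s c + k ∈ Ω ↔ k ∈ U₂ := by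
    rw [hΩ hk, hs, hU hc, add_sub_cancel_left]
  obtain ⟨c₀, hc₀⟩ : ∃ c : G ⧸ K, c ≠ 0 :=
    ⟨g₀, fun h => hg₀ ((QuotientAddGroup.eq_zero_iff g₀).1 h)⟩
  have h0U₂ : (0 : G) ∈ U₂ := hQU₂ (zero_mem _)
  have h0Ω : (0 : G) ∈ Ω := (hΩ₁ (zero_mem _)).2 (hPU₁ (zero_mem _))
  have hsΩ {c : G ⧸ K} (hc : c ≠ 0) : s c ∈ Ω := by
    simpa using (hΩ₂ hc (zero_mem _)).2 h0U₂
  have hU₁K : U₁ ⊆ K := by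
    intro u hu
    obtain ⟨t, ht⟩ := htile.nonempty_right
    exact (K.add_mem_cancel_right (hTK ht)).1 (hT₁.mapsTo (show (u, t) ∈ U₁ ×ˢ T from ⟨hu, ht⟩))
  intro hPT
  rcases hPT Ω T htile with ⟨-, g, hg, hgΩ⟩ | ⟨T', hT', htile'⟩
  · have hadd {w : G} (hw : w ∈ Ω) : w + g ∈ Ω := hgΩ ▸ ⟨w, hw, rfl⟩
    by_cases hgK : g ∈ K
    · refine hg (hU₁U₂ g ((hΩ₁ hgK).1 ?_) ((hΩ₂ hc₀ hgK).1 (hadd (hsΩ hc₀))))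
      simpa using hadd h0Ω
    · have hc : (g : G ⧸ K) ≠ 0 := fun h => hgK ((QuotientAddGroup.eq_zero_iff g).1 h)
      obtain ⟨u, hu, hu'⟩ := hshift (g - s g)
      have h1 := hadd ((hΩ₁ (hU₁K hu)).2 hu)
      rw [add_comm, hΩ (hU₁K hu), hU hc, add_comm, add_sub_assoc] at h1
      exact hu' h1
  · refine htile'.not_isPeriodicSet_of_forall_prime (fun r hr x hx hrx => ?_) hT'
    by_cases hrp : r = p
    · subst hrp
      have hxK : x ∈ K := nsmulKer_mono ((dvd_pow_self r two_ne_zero).mul_right _) hrx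
      exact ⟨0, h0Ω, by rw [zero_add, hΩ₁ hxK]; exact hPU₁ hrx⟩
    by_cases hrq : r = q
    · subst hrq
      have hxK : x ∈ K := nsmulKer_mono ((dvd_pow_self r two_ne_zero).mul_left _) hrx
      exact ⟨s c₀, hsΩ hc₀, (hΩ₂ hc₀ hxK).2 (hQU₂ hrx)⟩
    · have hcop : r.Coprime (p ^ 2 * q ^ 2) :=
        (((Nat.coprime_primes hr hp).2 hrp).pow_right 2).mul_right
          (((Nat.coprime_primes hr hq).2 hrq).pow_right 2)
      have hc : (x : G ⧸ K) ≠ 0 := fun h0 =>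
        hx (eq_zero_of_coprime_of_mem_nsmulKer hcop hrx ((QuotientAddGroup.eq_zero_iff x).1 h0))
      exact ⟨0, h0Ω, by rw [zero_add, ← hs' x r hcop hrx]; exact hsΩ hc⟩

/-! ### Arithmetic of the group order -/

theorem hasPTProperty_zmod_of_forall_not_sq_dvd {N p : ℕ} [NeZero N] [Nontrivial (ZMod N)]
    (hp : p.Prime) (h : ∀ r : ℕ, r.Prime → r ≠ p → ¬ r ^ 2 ∣ N) : HasPTProperty (ZMod N) := by
  intro Ω T hT
  have hcard := hT.card_mul
  rw [Nat.card_zmod] at hcard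
  by_cases hd : ∃ r : ℕ, r.Prime ∧ r ∣ N ∧ ¬ r ∣ Nat.card Ω
  · obtain ⟨r, hr, hrN, hrΩ⟩ := hd
    exact .inr (hT.exists_periodic_of_not_dvd hr (by rwa [Nat.card_zmod]) hrΩ)
  push Not at hd
  refine hT.periodic_of_card_eq_prime_pow hp
    (Nat.eq_prime_pow_of_unique_prime_dvd (fun h0 => ?_) fun {r} hr hrT => ?_)
  · rw [h0, mul_zero] at hcard
    exact NeZero.ne N hcard.symm
  · by_contra hrp
    refine h r hr hrp ?_
    have h1 := mul_dvd_mul (hd r hr (hcard ▸ hrT.mul_left _)) hrT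
    rwa [← pow_two, hcard] at h1

theorem hasPTProperty_zmod_of_eq_sq_mul_sq {N p q : ℕ} [NeZero N] [Nontrivial (ZMod N)]
    (hp : p.Prime) (hq : q.Prime) (hpq : p ≠ q) (hN : N = p ^ 2 * q ^ 2) :
    HasPTProperty (ZMod N) := by
  intro Ω T hT
  have hcard := hT.card_mul
  rw [Nat.card_zmod] at hcard
  by_cases hd : ∃ r : ℕ, r.Prime ∧ r ∣ N ∧ ¬ r ∣ Nat.card Ω
  · obtain ⟨r, hr, hrN, hrΩ⟩ := hd
    exact .inr (hT.exists_periodic_of_not_dvd hr (by rwa [Nat.card_zmod]) hrΩ)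
  push Not at hd
  obtain ⟨c, hc⟩ := ((Nat.coprime_primes hp hq).2 hpq).mul_dvd_of_dvd_of_dvd
    (hd p hp (hN ▸ (dvd_pow_self p two_ne_zero).mul_right _))
    (hd q hq (hN ▸ (dvd_pow_self q two_ne_zero).mul_left _))
  have hcT : c * Nat.card T = p * q := by
    refine Nat.eq_of_mul_eq_mul_left (Nat.mul_pos hp.pos hq.pos) ?_
    rw [← mul_assoc, ← hc, hcard, hN]
    ring
  have hprime {r l : ℕ} (hr : r.Prime) (hl : l.Prime) (hrc : r ∣ c) (hrl : c * Nat.card T = r * l) :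
      IsPeriodicSet Ω ∨ ∃ T' : Set (ZMod N), IsPeriodicSet T' ∧ IsTilingPair Ω T' := by
    obtain ⟨c', rfl⟩ := hrc
    rw [mul_assoc] at hrl
    have h1 := Dvd.intro_left c' (Nat.eq_of_mul_eq_mul_left hr.pos hrl)
    rcases (Nat.dvd_prime hl).1 h1 with h1 | h1
    · exact hT.periodic_of_card_eq_prime_pow (a := 0) hl (by rw [h1, pow_zero])
    · exact hT.periodic_of_card_eq_prime_pow (a := 1) hl (by rw [h1, pow_one])
  by_cases hc1 : c = 1
  · exact (hT.periodic_of_card_eq_mul hp hq hpq hN (by rw [hc, hc1, mul_one])).imp_right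
      fun h => ⟨T, h, hT⟩
  · obtain ⟨r, hr, hrc⟩ := Nat.exists_prime_and_dvd hc1
    rcases hr.dvd_mul.1 (hcT ▸ hrc.mul_right _) with h1 | h1
    · obtain rfl := (Nat.prime_dvd_prime_iff_eq hr hp).1 h1
      exact hprime hr hq hrc hcT
    · obtain rfl := (Nat.prime_dvd_prime_iff_eq hr hq).1 h1
      exact hprime hr hp hrc (by rw [hcT, mul_comm])

theorem not_hasPTProperty_of_sq_dvd {G : Type*} [AddCommGroup G] [Finite G] [IsAddCyclic G]
    {p q : ℕ} (hp : p.Prime) (hq : q.Prime) (hpq : p ≠ q) (hpG : p ^ 2 ∣ Nat.card G)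
    (hqG : q ^ 2 ∣ Nat.card G) (hne : Nat.card G ≠ p ^ 2 * q ^ 2) : ¬ HasPTProperty G := by
  obtain ⟨g, hg⟩ := IsAddCyclic.exists_ofOrder_eq_natCard (α := G)
  have hpos : 0 < Nat.card G := Nat.card_pos
  have key {r : ℕ} (hr : r.Prime) (hrG : r ^ 2 ∣ Nat.card G) :
      ∃ a : G, r ^ 2 • a = 0 ∧ r • a ≠ 0 := by
    obtain ⟨c, hc⟩ := hrG
    refine ⟨c • g, ?_, fun h => ?_⟩
    · rw [smul_smul, ← hc, ← hg, addOrderOf_nsmul_eq_zero]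
    · rw [smul_smul] at h
      have hdvd := addOrderOf_dvd_of_nsmul_eq_zero h
      rw [hg, hc, pow_two, mul_assoc] at hdvd
      rw [hc] at hpos
      have hrc : 0 < r * c := Nat.mul_pos hr.pos (Nat.pos_of_mul_pos_left hpos)
      have := Nat.le_of_dvd hrc hdvd
      nlinarith [hr.two_le]
  obtain ⟨a, ha, ha'⟩ := key hp hpG
  obtain ⟨b, hb, hb'⟩ := key hq hqG
  refine not_hasPTProperty_of_nsmul_ne_zero hp hq hpq ha ha' hb hb' (g₀ := g) fun h => hne ?_
  exact Nat.dvd_antisymm (hg ▸ addOrderOf_dvd_of_nsmul_eq_zero h)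
    ((Nat.Coprime.pow _ _ ((Nat.coprime_primes hp hq).2 hpq)).mul_dvd_of_dvd_of_dvd hpG hqG)

theorem exists_addEquiv_addSubgroup_zmod_iff {G : Type*} [AddCommGroup G] [Finite G]
    [IsAddCyclic G] {M : ℕ} (hM : M ≠ 0) :
    (∃ H : AddSubgroup (ZMod M), Nonempty (G ≃+ H)) ↔ Nat.card G ∣ M := by
  constructor
  · rintro ⟨H, ⟨e⟩⟩
    rw [Nat.card_congr e.toEquiv]
    exact H.card_addSubgroup_dvd_card.trans (Nat.card_zmod M).dvd
  · rintro ⟨c, hc⟩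
    have hc0 : 0 < c := Nat.pos_of_ne_zero (by rintro rfl; exact hM hc)
    refine ⟨AddSubgroup.zmultiples ((c : ℕ) : ZMod M), ⟨addEquivOfAddCyclicCardEq ?_⟩⟩
    rw [Nat.card_zmultiples, ZMod.addOrderOf_coe _ hM, hc, Nat.gcd_eq_right (dvd_mul_left c _),
      Nat.mul_div_cancel _ hc0]

theorem not_sq_dvd_of_dvd_pow_mul_prod {N k n r : ℕ} {p : Fin (k + 1) → ℕ}
    (hp : ∀ i, (p i).Prime) (hinj : Function.Injective p)
    (hN : N ∣ p 0 ^ n * ∏ i : Fin k, p i.succ) (hr : r.Prime) (hr0 : r ≠ p 0) : ¬ r ^ 2 ∣ N := by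
  intro h
  have hcop : (r ^ 2).Coprime (p 0 ^ n) :=
    Nat.Coprime.pow _ _ ((Nat.coprime_primes hr (hp 0)).2 hr0)
  have h1 := hcop.dvd_of_dvd_mul_left (h.trans hN)
  have hsq : Squarefree (∏ i : Fin k, p i.succ) := by
    refine Finset.squarefree_prod_of_pairwise_isCoprime (fun i _ j _ hij => ?_)
      fun i _ => (hp _).prime.squarefree
    rw [Function.onFun, ← Nat.coprime_iff_isRelPrime]
    exact (Nat.coprime_primes (hp _) (hp _)).2 fun h => hij (Fin.succ_injective _ (hinj h))
  exact hr.not_isUnit (hsq r (pow_two r ▸ h1))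

theorem exists_dvd_pow_mul_prod {N p : ℕ} (hN : N ≠ 0) (hp : p.Prime)
    (h : ∀ r : ℕ, r.Prime → r ≠ p → ¬ r ^ 2 ∣ N) :
    ∃ (k n : ℕ) (p : Fin (k + 1) → ℕ), 1 ≤ n ∧ (∀ i, (p i).Prime) ∧ Function.Injective p ∧
      N ∣ p 0 ^ n * ∏ i : Fin k, p i.succ := by
  let S := N.primeFactors.erase p
  let e := S.orderEmbOfFin rfl
  have he (i) : e i ∈ S := S.orderEmbOfFin_mem rfl i
  -- The exponent `N` is large enough, as `p ^ a ∣ N` implies `a < N`.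
  refine ⟨S.card, N, Fin.cons p e, Nat.one_le_iff_ne_zero.2 hN, ?_, ?_, ?_⟩
  · refine Fin.cases (by simpa using hp) fun i => ?_
    simpa using Nat.prime_of_mem_primeFactors (Finset.mem_of_mem_erase (he i))
  · refine Fin.cons_injective_iff.2 ⟨?_, e.injective⟩
    rintro ⟨i, hi⟩
    exact Finset.ne_of_mem_erase (he i) hi
  · simp only [Fin.cons_zero, Fin.cons_succ]
    rw [Nat.dvd_iff_prime_pow_dvd_dvd]
    intro r a hr hra
    by_cases hrp : r = p
    · subst hrp
      refine (pow_dvd_pow r ?_).mul_right _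
      exact (Nat.lt_pow_self hr.one_lt).le.trans (Nat.le_of_dvd (Nat.pos_of_ne_zero hN) hra)
    · have ha : a < 2 := by
        by_contra! ha
        exact h r hr hrp ((pow_dvd_pow r ha).trans hra)
      interval_cases a
      · simp
      · rw [pow_one] at hra ⊢
        have hrS : r ∈ Set.range e := by
          rw [Finset.range_orderEmbOfFin]
          exact Finset.mem_erase.2 ⟨hrp, Nat.mem_primeFactors.2 ⟨hr, hra, hN⟩⟩
        obtain ⟨i, rfl⟩ := hrS
        exact (Finset.dvd_prod_of_mem (fun i => e i) (Finset.mem_univ i)).mul_left _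

theorem theorem1p1 (G : Type*) [AddCommGroup G] [Finite G] [IsAddCyclic G] [Nontrivial G] :
    HasPTProperty G ↔
      (∃ (k n : ℕ) (p : Fin (k + 1) → ℕ),
          1 ≤ n ∧ (∀ i, (p i).Prime) ∧ Function.Injective p ∧
          ∃ H : AddSubgroup (ZMod (p 0 ^ n * ∏ i : Fin k, p i.succ)), Nonempty (G ≃+ H)) ∨
      (∃ p q : ℕ, p.Prime ∧ q.Prime ∧ p ≠ q ∧
          ∃ H : AddSubgroup (ZMod (p ^ 2 * q ^ 2)), Nonempty (G ≃+ H)) := by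
  have hG0 : Nat.card G ≠ 0 := Nat.card_pos.ne'
  have hsub {p q : ℕ} (hp : p.Prime) (hq : q.Prime) :=
    exists_addEquiv_addSubgroup_zmod_iff (G := G) (M := p ^ 2 * q ^ 2)
      (Nat.mul_pos (pow_pos hp.pos 2) (pow_pos hq.pos 2)).ne'
  have hsub' {k n : ℕ} {p : Fin (k + 1) → ℕ} (hp : ∀ i, (p i).Prime) :=
    exists_addEquiv_addSubgroup_zmod_iff (G := G) (M := p 0 ^ n * ∏ i : Fin k, p i.succ)
      (mul_ne_zero (pow_ne_zero _ (hp 0).ne_zero) (Finset.prod_ne_zero_iff.2 fun i _ =>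
        (hp i.succ).ne_zero))
  constructor
  · intro hPT
    by_cases h : ∃ p : ℕ, p.Prime ∧ ∀ r : ℕ, r.Prime → r ≠ p → ¬ r ^ 2 ∣ Nat.card G
    · obtain ⟨p, hp, hpG⟩ := h
      obtain ⟨k, n, p', hn, hp', hinj, hdvd⟩ := exists_dvd_pow_mul_prod hG0 hp hpG
      exact .inl ⟨k, n, p', hn, hp', hinj, (hsub' hp').2 hdvd⟩
    · push Not at h
      -- The prime `2` is an arbitrary choice; it yields some prime whose square divides `|G|`.
      obtain ⟨p, hp, -, hpG⟩ := h 2 Nat.prime_two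
      obtain ⟨q, hq, hqp, hqG⟩ := h p hp
      refine .inr ⟨p, q, hp, hq, hqp.symm, (hsub hp hq).2 ?_⟩
      by_contra hne
      exact not_hasPTProperty_of_sq_dvd hp hq hqp.symm hpG hqG (fun h => hne h.dvd) hPT
  · intro h
    have : NeZero (Nat.card G) := ⟨hG0⟩
    let e : ZMod (Nat.card G) ≃+ G := zmodAddCyclicAddEquiv inferInstance
    have : Nontrivial (ZMod (Nat.card G)) := e.toEquiv.nontrivial
    refine hasPTProperty_of_addEquiv e.symm ?_
    rcases h with ⟨k, n, p, -, hp, hinj, hH⟩ | ⟨p, q, hp, hq, hpq, hH⟩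
    · exact hasPTProperty_zmod_of_forall_not_sq_dvd (hp 0) fun r hr hr0 =>
        not_sq_dvd_of_dvd_pow_mul_prod hp hinj ((hsub' hp).1 hH) hr hr0
    · have hdvd := (hsub hp hq).1 hH
      by_cases hpG : p ^ 2 ∣ Nat.card G
      · by_cases hqG : q ^ 2 ∣ Nat.card G
        · exact hasPTProperty_zmod_of_eq_sq_mul_sq hp hq hpq (Nat.dvd_antisymm hdvd
            ((Nat.Coprime.pow _ _ ((Nat.coprime_primes hp hq).2 hpq)).mul_dvd_of_dvd_of_dvd
              hpG hqG))
        · refine hasPTProperty_zmod_of_forall_not_sq_dvd hp fun r hr hrp hrG => hqG ?_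
          have h1 : r ∣ p ^ 2 * q ^ 2 := (dvd_pow_self r two_ne_zero).trans (hrG.trans hdvd)
          rcases hr.dvd_mul.1 h1 with h1 | h1
          · exact absurd ((Nat.prime_dvd_prime_iff_eq hr hp).1 (hr.dvd_of_dvd_pow h1)) hrp
          · rwa [← (Nat.prime_dvd_prime_iff_eq hr hq).1 (hr.dvd_of_dvd_pow h1)]
      · refine hasPTProperty_zmod_of_forall_not_sq_dvd hq fun r hr hrq hrG => hpG ?_
        have h1 : r ∣ p ^ 2 * q ^ 2 := (dvd_pow_self r two_ne_zero).trans (hrG.trans hdvd)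
        rcases hr.dvd_mul.1 h1 with h1 | h1
        · rwa [← (Nat.prime_dvd_prime_iff_eq hr hp).1 (hr.dvd_of_dvd_pow h1)]
        · exact absurd ((Nat.prime_dvd_prime_iff_eq hr hq).1 (hr.dvd_of_dvd_pow h1)) hrq
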